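/- Let $q\ge 2$ and let $F$ be a finite group acting faithfully and transitively on the alphabet $\{0,\dots,q-1\}$. Let $\mathbb{T}$ be the $(q+1)$-regular tree with a distinguished end, a bi-infinite ray $(\gamma_n)_{n\in\mathbb{Z}}$ converging to this end as $n\to+\infty$, and the vertex $o=\gamma_0$ on it. The parent of a vertex is its neighbour in the direction of the end; the $q$ other neighbours are its children, and they are labelled bijectively by $\{0,\dots,q-1\}$ in such a way that every vertex of the ray is labelled $0$. The discrete affine group $\mathrm{DA}_F(\mathbb{T})\le\mathrm{Aut}(\mathbb{T})$ is the group generated by the label-preserving automorphism $t$ with $t(\gamma_n)=\gamma_{n+1}$ for all $n$, together with the automorphisms $a_f$, $f\in F$, where $a_f$ fixes every vertex that is not a strict descendant of $o$, maps the child of $o$ labelled $i$ to the child of $o$ labelled $f\cdot i$, and preserves the labels of all vertices that are not children of $o$. Then $\mathrm{DA}_F(\mathbb{T})$ is finitely generated, it is locally-finite-by-$\mathbb{Z}$ (there is an exact sequence $1\to L\to \mathrm{DA}_F(\mathbb{T})\to\mathbb{Z}\to 1$ in which every finitely generated subgroup of $L$ is finite), and it does not have Shalom's property $H_{\mathrm{FD}}$: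 there is a unitary representation $\pi$ of $\mathrm{DA}_F(\mathbb{T})$ on a complex Hilbert space $\mathcal{H}$ with no non-zero finite-dimensional invariant subspace and with non-zero reduced cohomology $$\overline{H}^1(\mathrm{DA}_F(\mathbb{T}),\pi)=Z^1/\overline{B^1}\neq 0,$$ where $Z^1$ is the space of $1$-cocycles, that is, of maps $b:\mathrm{DA}_F(\mathbb{T})\to\mathcal{H}$ with $b(gh)=b(g)+\pi_g b(h)$, $B^1\subseteq Z^1$ is the space of $1$-coboundaries $g\mapsto v-\pi_g v$ with $v\in\mathcal{H}$, and the closure is taken in the topology of pointwise convergence. -/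

import Mathlib

universe u

/-! ## Shalom's property H_FD -/

section Cohomology

variable {G : Type*} [Group G] {H : Type*} [NormedAddCommGroup H] [InnerProductSpace ℂ H]

/-- The space `Z¹(G, π)` of 1-cocycles of a unitary representation `π` of `G` on `H`. It carries
the topology of pointwise convergence, which for the discrete group `G` is uniform convergence on
compact (that is, finite) subsets. -/
def cocycles (π : G →* (H ≃ₗᵢ[ℂ] H)) : Submodule ℂ (G → H) where
  carrier := {b | ∀ g h, b (g * h) = b g + π g (b h)}
  add_mem' := by
    intro a b ha hb g h
    simp only [Pi.add_apply, ha g h, hb g h, map_add]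
    abel
  zero_mem' := by
    intro g h
    simp
  smul_mem' := by
    intro c b hb g h
    simp only [Pi.smul_apply, hb g h, map_smul, smul_add]

/-- The space `B¹(G, π)` of 1-coboundaries, as a subspace of the space of 1-cocycles. -/
def coboundaries (π : G →* (H ≃ₗᵢ[ℂ] H)) : Submodule ℂ (cocycles π) where
  carrier := {b | ∃ v : H, ∀ g, (b : G → H) g = v - π g v}
  add_mem' := by
    rintro a b ⟨v, hv⟩ ⟨w, hw⟩
    refine ⟨v + w, fun g => ?_⟩
    simp only [Submodule.coe_add, Pi.add_apply, hv g, hw g, map_add]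
    abel
  zero_mem' := ⟨0, fun g => by simp⟩
  smul_mem' := by
    rintro c b ⟨v, hv⟩
    refine ⟨c • v, fun g => ?_⟩
    simp only [Submodule.coe_smul, Pi.smul_apply, hv g, map_smul, smul_sub]

/-- The first reduced cohomology `Z¹(G, π) / closure of B¹(G, π)`. -/
abbrev ReducedH1 (π : G →* (H ≃ₗᵢ[ℂ] H)) : Type _ :=
  cocycles π ⧸ (coboundaries π).topologicalClosure

end Cohomology

/-- Shalom's property H_FD: every unitary representation of `G` on a complex Hilbert space with
non-zero first reduced cohomology has a non-zero finite dimensional subrepresentation.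
(Hilbert spaces in the universe of `G` suffice: one may always pass to the closed span of the
values of a cocycle.) -/
def HasPropertyHFD (G : Type u) [Group G] : Prop :=
  ∀ (H : Type u) [NormedAddCommGroup H] [InnerProductSpace ℂ H] [CompleteSpace H]
    (π : G →* (H ≃ₗᵢ[ℂ] H)), Nontrivial (ReducedH1 π) →
      ∃ W : Submodule ℂ H, W ≠ ⊥ ∧ FiniteDimensional ℂ W ∧ ∀ g, ∀ w ∈ W, π g w ∈ W

/-! ## Locally-finite-by-ℤ groups -/

/-- Every finitely generated subgroup is finite. -/
def IsLocallyFiniteGroup (L : Type*) [Group L] : Prop :=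
  ∀ K : Subgroup L, K.FG → Finite K

/-- `G` is an extension `1 → L → G → ℤ → 1` with `L` locally finite. -/
def IsLocallyFiniteByInt (G : Type*) [Group G] : Prop :=
  ∃ φ : G →* Multiplicative ℤ, Function.Surjective φ ∧ IsLocallyFiniteGroup φ.ker

/-! ## The regular tree with a distinguished end, in coordinates

Every vertex has one parent (its neighbour in the direction of the distinguished end) and `q`
children, which are labelled by the letters of the alphabet `Fin q`. -/

/-- A vertex of the `(q+1)`-regular tree. `level` increases by one towards the distinguished end;
for `k ≥ level`, `label k` is the label of the ancestor at level `k` as a child of the ancestor at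
level `k + 1`. The values of `label` below `level` carry no information and are set to `0`.
As the distinguished bi-infinite ray has all labels `0`, and every vertex has an ancestor on it,
the labels are eventually `0`. -/
@[ext] structure TreeVertex (q : ℕ) [NeZero q] where
  level : ℤ
  label : ℤ → Fin q
  label_of_lt : ∀ k < level, label k = 0
  label_eventually : ∃ N, ∀ k ≥ N, label k = 0

namespace TreeVertex

variable {q : ℕ} [NeZero q]

/-- The neighbour of `x` in the direction of the distinguished end. -/
def parent (x : TreeVertex q) : TreeVertex q where
  level := x.level + 1
  label := Function.update x.label x.level 0
  label_of_lt := by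
    intro k hk
    by_cases h : k = x.level
    · simp [h]
    · rw [Function.update_of_ne h]
      exact x.label_of_lt k (by omega)
  label_eventually := by
    obtain ⟨N, hN⟩ := x.label_eventually
    refine ⟨N, fun k hk => ?_⟩
    by_cases h : k = x.level
    · simp [h]
    · rw [Function.update_of_ne h]
      exact hN k hk

/-- The child of `x` with label `i`. -/
def child (x : TreeVertex q) (i : Fin q) : TreeVertex q where
  level := x.level - 1
  label := Function.update x.label (x.level - 1) i
  label_of_lt := by
    intro k hk
    rw [Function.update_of_ne (by omega)]
    exact x.label_of_lt k (by omega)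
  label_eventually := by
    obtain ⟨N, hN⟩ := x.label_eventually
    refine ⟨max N x.level, fun k hk => ?_⟩
    rw [Function.update_of_ne (by have := le_max_right N x.level; omega)]
    exact hN k (le_trans (le_max_left _ _) hk)

/-- The distinguished bi-infinite ray; the distinguished end is its limit as `n → +∞`, and the
distinguished vertex is `ray 0`. -/
def ray (q : ℕ) [NeZero q] (n : ℤ) : TreeVertex q where
  level := n
  label := fun _ => 0
  label_of_lt := fun _ _ => rfl
  label_eventually := ⟨0, fun _ _ => rfl⟩

/-- `x` lies in one of the `q` subtrees hanging below the distinguished vertex, that is, `x` is a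
strict descendant of `ray 0`. -/
def IsBelow (x : TreeVertex q) : Prop :=
  x.level < 0 ∧ ∀ k ≥ 0, x.label k = 0

/-- Change the label of the level `-1` ancestor of a strict descendant `x` of `ray 0` to
`i`, keeping the other labels. -/
def relabel (x : TreeVertex q) (hx : x.IsBelow) (i : Fin q) : TreeVertex q where
  level := x.level
  label := Function.update x.label (-1) i
  label_of_lt := by
    intro k hk
    have := hx.1
    rw [Function.update_of_ne (by omega)]
    exact x.label_of_lt k hk
  label_eventually :=
    ⟨0, fun k hk => by rw [Function.update_of_ne (by omega)]; exact hx.2 k hk⟩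

theorem relabel_isBelow (x : TreeVertex q) (hx : x.IsBelow) (i : Fin q) :
    (x.relabel hx i).IsBelow :=
  ⟨hx.1, fun k hk => by
    simp only [relabel]
    rw [Function.update_of_ne (by omega)]
    exact hx.2 k hk⟩

open Classical in
/-- Permute the `q` subtrees below `ray 0` by `f`, preserving all labels except those of the
children of `ray 0`, and fix all the other vertices. -/
noncomputable def permuteFun {F : Type*} [Group F] [MulAction F (Fin q)] (f : F)
    (x : TreeVertex q) : TreeVertex q :=
  if hx : x.IsBelow then x.relabel hx (f • x.label (-1)) else x

theorem permuteFun_of_isBelow {F : Type*} [Group F] [MulAction F (Fin q)] (f : F)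
    (x : TreeVertex q) (hx : x.IsBelow) :
    permuteFun f x = x.relabel hx (f • x.label (-1)) := dif_pos hx

theorem permuteFun_of_not_isBelow {F : Type*} [Group F] [MulAction F (Fin q)] (f : F)
    (x : TreeVertex q) (hx : ¬ x.IsBelow) : permuteFun f x = x := dif_neg hx

theorem permuteFun_mul {F : Type*} [Group F] [MulAction F (Fin q)] (f g : F)
    (x : TreeVertex q) : permuteFun f (permuteFun g x) = permuteFun (f * g) x := by
  by_cases hx : x.IsBelow
  · have h := x.relabel_isBelow hx (g • x.label (-1))
    rw [permuteFun_of_isBelow g x hx, permuteFun_of_isBelow _ _ h, permuteFun_of_isBelow _ x hx]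
    ext1
    · rfl
    · simp [relabel, mul_smul]
  · simp only [permuteFun_of_not_isBelow _ x hx]

theorem permuteFun_one {F : Type*} [Group F] [MulAction F (Fin q)]
    (x : TreeVertex q) : permuteFun (1 : F) x = x := by
  by_cases hx : x.IsBelow
  · rw [permuteFun_of_isBelow _ x hx]
    ext1
    · rfl
    · simp [relabel]
  · exact permuteFun_of_not_isBelow _ x hx

theorem permuteFun_parent {F : Type*} [Group F] [MulAction F (Fin q)] (f : F)
    (x : TreeVertex q) : permuteFun f (parent x) = parent (permuteFun f x) := by
  by_cases hx : x.IsBelow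
  · by_cases h1 : x.level = -1
    · have hp : ¬ (parent x).IsBelow := fun h => by
        have := h.1
        simp only [parent] at this
        omega
      simp only [permuteFun, dif_pos hx, dif_neg hp]
      ext1
      · rfl
      · simp [parent, relabel, h1]
    · have hp : (parent x).IsBelow := by
        refine ⟨?_, fun k hk => ?_⟩
        · have := hx.1
          simp only [parent]
          omega
        · have := hx.1
          simp only [parent]
          rw [Function.update_of_ne (by omega)]
          exact hx.2 k hk
      simp only [permuteFun, dif_pos hx, dif_pos hp]
      ext1
      · rfl
      · simp only [parent, relabel]
        rw [Function.update_of_ne (Ne.symm h1), Function.update_comm (Ne.symm h1)]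
  · have hp : ¬ (parent x).IsBelow := fun h => by
      apply hx
      have h1 := h.1
      simp only [parent] at h1
      refine ⟨by omega, fun k hk => ?_⟩
      have h2 := h.2 k hk
      simp only [parent] at h2
      rwa [Function.update_of_ne (by omega)] at h2
    simp only [permuteFun, dif_neg hx, dif_neg hp]

/-- Translate all labels by `m` levels. -/
def translate (m : ℤ) (x : TreeVertex q) : TreeVertex q where
  level := x.level + m
  label := fun k => x.label (k - m)
  label_of_lt := fun k hk => x.label_of_lt (k - m) (by omega)
  label_eventually := by
    obtain ⟨N, hN⟩ := x.label_eventually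
    exact ⟨N + m, fun k hk => hN (k - m) (by omega)⟩

theorem translate_translate (m n : ℤ) (h : n + m = 0) (x : TreeVertex q) :
    translate m (translate n x) = x := by
  obtain rfl : n = -m := by omega
  ext1
  · simp [translate]
  · simp [translate]

theorem translate_parent (m : ℤ) (x : TreeVertex q) :
    translate m (parent x) = parent (translate m x) := by
  ext1
  · simp only [translate, parent]
    omega
  · funext k
    simp only [translate, parent, Function.update_apply]
    by_cases h : k = x.level + m
    · simp [h]
    · rw [if_neg h, if_neg (by omega)]

end TreeVertex

/-- The `(q+1)`-regular tree: every vertex is joined to its parent. -/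
def regularTree (q : ℕ) [NeZero q] : SimpleGraph (TreeVertex q) where
  Adj x y := y = x.parent ∨ x = y.parent
  symm := ⟨fun _ _ h => h.symm⟩
  loopless := ⟨fun x h => by
    have h' : x = x.parent := h.elim id id
    have := congrArg TreeVertex.level h'
    simp [TreeVertex.parent] at this⟩

section Sanity

variable {q : ℕ} [NeZero q]

theorem regularTree_neighborSet (x : TreeVertex q) :
    (regularTree q).neighborSet x = insert x.parent (Set.range x.child) := by
  ext y
  simp only [SimpleGraph.mem_neighborSet, regularTree, Set.mem_insert_iff, Set.mem_range]
  refine or_congr Iff.rfl ⟨?_, ?_⟩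
  · rintro rfl
    refine ⟨y.label y.level, ?_⟩
    ext1
    · simp [TreeVertex.child, TreeVertex.parent]
    · simp [TreeVertex.child, TreeVertex.parent]
  · rintro ⟨i, rfl⟩
    ext1
    · simp [TreeVertex.child, TreeVertex.parent]
    · simp [TreeVertex.child, TreeVertex.parent, x.label_of_lt (x.level - 1) (by omega)]

/-- Every vertex has exactly `q + 1` neighbours. -/
theorem regularTree_ncard_neighborSet (x : TreeVertex q) :
    ((regularTree q).neighborSet x).ncard = q + 1 := by
  have hinj : Function.Injective x.child := fun i j h => by
    have := congrFun (congrArg TreeVertex.label h) (x.level - 1)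
    simpa [TreeVertex.child] using this
  rw [regularTree_neighborSet, Set.ncard_insert_of_notMem _ (Set.toFinite _)]
  · rw [← Set.image_univ, Set.ncard_image_of_injective _ hinj, Set.ncard_univ]
    simp
  · rintro ⟨i, h⟩
    have := congrArg TreeVertex.level h
    simp only [TreeVertex.child, TreeVertex.parent] at this
    omega

theorem regularTree_reachable_ray (x : TreeVertex q) (n : ℕ) :
    ∀ (m : ℤ), m - x.level = n → (∀ k ≥ m, x.label k = 0) →
      (regularTree q).Reachable x (TreeVertex.ray q m) := by
  induction n generalizing x with
  | zero =>
    intro m hm h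
    have : x = TreeVertex.ray q m := by
      ext1
      · simp only [TreeVertex.ray]
        push_cast at hm
        omega
      · funext k
        by_cases hk : k < x.level
        · exact x.label_of_lt k hk
        · exact h k (by push_cast at hm; omega)
    rw [this]
  | succ n ih =>
    intro m hm h
    push_cast at hm
    have h1 : (regularTree q).Adj x x.parent := Or.inl rfl
    refine h1.reachable.trans (ih x.parent m ?_ ?_)
    · simp only [TreeVertex.parent]
      omega
    · intro k hk
      simp only [TreeVertex.parent]
      rw [Function.update_of_ne (by omega)]
      exact h k hk

/-- The graph `regularTree q` is a tree. -/
theorem regularTree_isTree (q : ℕ) [NeZero q] : (regularTree q).IsTree := by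
  constructor
  · have : Nonempty (TreeVertex q) := ⟨TreeVertex.ray q 0⟩
    refine SimpleGraph.Connected.mk fun x y => ?_
    obtain ⟨N, hN⟩ := x.label_eventually
    obtain ⟨M, hM⟩ := y.label_eventually
    set m := max (max N M) (max x.level y.level) with hm
    have hx := regularTree_reachable_ray x (m - x.level).toNat m
      (by rw [Int.toNat_of_nonneg]; omega) (fun k hk => hN k (by omega))
    have hy := regularTree_reachable_ray y (m - y.level).toNat m
      (by rw [Int.toNat_of_nonneg]; omega) (fun k hk => hM k (by omega))
    exact hx.trans hy.symm
  · have key : ∀ x : TreeVertex q, ¬ ((regularTree q) \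
        SimpleGraph.fromEdgeSet {s(x, x.parent)}).Reachable x x.parent := by
      rintro x ⟨p⟩
      have inv : ∀ (a b : TreeVertex q) (_ : ((regularTree q) \
          SimpleGraph.fromEdgeSet {s(x, x.parent)}).Walk a b),
          (∃ k : ℕ, TreeVertex.parent^[k] a = x) → ∃ k : ℕ, TreeVertex.parent^[k] b = x := by
        intro a b w
        induction w with
        | nil => exact id
        | @cons a c b h _ ih =>
          rintro ⟨k, hk⟩
          apply ih
          obtain ⟨h1, h2⟩ := h
          rcases h1 with h1 | h1
          · cases k with
            | zero =>
              exfalso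
              apply h2
              have ha : a = x := hk
              subst ha
              rw [h1]
              rw [SimpleGraph.fromEdgeSet_adj]
              refine ⟨rfl, fun h3 => ?_⟩
              have := congrArg TreeVertex.level h3
              simp [TreeVertex.parent] at this
            | succ k => exact ⟨k, by rw [h1]; exact hk⟩
          · exact ⟨k + 1, by rw [Function.iterate_succ_apply, ← h1]; exact hk⟩
      obtain ⟨k, hk⟩ := inv _ _ p ⟨0, rfl⟩
      have hl : ∀ (k : ℕ) (z : TreeVertex q),
          (TreeVertex.parent^[k] z).level = z.level + k := by
        intro k
        induction k with
        | zero => intro z; simp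
        | succ k ih =>
          intro z
          rw [Function.iterate_succ_apply, ih]
          simp only [TreeVertex.parent]
          push_cast
          ring
      have := congrArg TreeVertex.level hk
      rw [hl] at this
      simp only [TreeVertex.parent] at this
      omega
    rw [SimpleGraph.isAcyclic_iff_forall_adj_isBridge]
    intro v w hvw
    rcases hvw with rfl | rfl
    · exact SimpleGraph.isBridge_iff.2 (key v)
    · rw [Sym2.eq_swap]
      exact SimpleGraph.isBridge_iff.2 (key w)

end Sanity

/-! ## The discrete affine group -/

/-- A permutation of the vertices that commutes with taking parents is an automorphism of the
tree. -/
def treeAut {q : ℕ} [NeZero q] (e : Equiv.Perm (TreeVertex q))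
    (he : ∀ x, e x.parent = (e x).parent) : regularTree q ≃g regularTree q where
  toEquiv := e
  map_rel_iff' := by
    intro x y
    change (e y = (e x).parent ∨ e x = (e y).parent) ↔ (y = x.parent ∨ x = y.parent)
    rw [← he, ← he, e.apply_eq_iff_eq, e.apply_eq_iff_eq]

/-- The automorphism that shifts the distinguished ray by one step and preserves labels. -/
def treeShift (q : ℕ) [NeZero q] : regularTree q ≃g regularTree q :=
  treeAut
    { toFun := TreeVertex.translate 1
      invFun := TreeVertex.translate (-1)
      left_inv := TreeVertex.translate_translate (-1) 1 (by norm_num)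
      right_inv := TreeVertex.translate_translate 1 (-1) (by norm_num) }
    (TreeVertex.translate_parent 1)

theorem treeShift_ray (q : ℕ) [NeZero q] (n : ℤ) :
    treeShift q (TreeVertex.ray q n) = TreeVertex.ray q (n + 1) := rfl

/-- The automorphism that permutes by `f` the `q` subtrees (not containing the end) obtained by
removing the vertex `ray 0`. -/
noncomputable def treePermute (q : ℕ) [NeZero q] {F : Type*} [Group F] [MulAction F (Fin q)]
    (f : F) : regularTree q ≃g regularTree q :=
  treeAut
    { toFun := TreeVertex.permuteFun f
      invFun := TreeVertex.permuteFun f⁻¹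
      left_inv := fun x => by
        rw [TreeVertex.permuteFun_mul, inv_mul_cancel, TreeVertex.permuteFun_one]
      right_inv := fun x => by
        rw [TreeVertex.permuteFun_mul, mul_inv_cancel, TreeVertex.permuteFun_one] }
    (TreeVertex.permuteFun_parent f)

theorem treePermute_child (q : ℕ) [NeZero q] {F : Type*} [Group F] [MulAction F (Fin q)]
    (f : F) (i : Fin q) : treePermute q f ((TreeVertex.ray q 0).child i) =
      (TreeVertex.ray q 0).child (f • i) := by
  have h : ((TreeVertex.ray q 0).child i).IsBelow := by
    refine ⟨by simp [TreeVertex.child, TreeVertex.ray], fun k hk => ?_⟩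
    simp only [TreeVertex.child, TreeVertex.ray]
    rw [Function.update_of_ne (by omega)]
  refine (TreeVertex.permuteFun_of_isBelow f _ h).trans ?_
  ext1
  · rfl
  · simp [TreeVertex.relabel, TreeVertex.child, TreeVertex.ray]

/-- The discrete affine group `DA_F(𝕋)` of the `(q+1)`-regular tree. -/
def discreteAffineGroup (q : ℕ) [NeZero q] (F : Type*) [Group F] [MulAction F (Fin q)] :
    Subgroup (regularTree q ≃g regularTree q) :=
  Subgroup.closure (insert (treeShift q) (Set.range fun f : F => treePermute q f))

/-!
The interesting part is the failure of property `H_FD`. The representation is the permutation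
representation of the group on `ℓ²` of the vertices of the tree. The shift has only infinite orbits
there, so an eigenvector of the shift would be square-summable with constant modulus on infinite
sets; hence there is no finite dimensional subrepresentation
(`permutationRep_invariant_eq_bot`).

Let `v` be the function that sends a vertex to a non-constant, mean zero function of its own label.
The shift preserves `v`, and a local permutation changes it only at the `q` children of `ray 0`, so
`g ↦ v - g v` is a cocycle (`labelCocycle`), although `v` is not square-summable. That its reduced
class does not vanish is a transience phenomenon. A square-summable flow without divergence on the
Schreier graph of the vertices pairs to zero with all coboundaries, and the pairing is continuous
(`nontrivial_reducedH1_of_pairing`). The Schreier graph contains a `q`-ary tree: below `ray 0`, the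
inverse shift increases the depth of a vertex by one, and the local permutations then choose its new
topmost label. A flow that starts at the children of `ray 0`, with total mass zero, and splits
equally in this tree has finite energy because `q ≥ 2` (`TreeVertex.memℓp_flow`), and transitivity
of the action on the alphabet is what allows it to be balanced by the local permutations
(`TreeVertex.sum_shiftDivergence_permuteFun`). The bottom label of a vertex is constant along the
flow, so `v` separates the branches, and the pairing of the flow with the cocycle is `1 - q ≠ 0`
(`sum_inner_affineFlow_labelCocycle`).

For the extension by `ℤ`, an element of the group moves all levels by the same amount, agrees with
a translation outside the subtree below some `ray N`, and translates the labels far down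
(`IsTranslationOutside`). Elements that fix the levels and share the same bound `N` form a finite
group, since they are determined by their action on a finite set of vertices
(`finite_boundedSupportSubgroup`).
-/

/-! ### Permutation representations on `ℓ²` -/

section PermutationRepresentation

variable {G X : Type*} [Group G] [MulAction G X]

theorem Memℓp.comp_injective {Y : Type*} {f : X → ℂ} (hf : Memℓp f 2) {e : Y → X}
    (he : Function.Injective e) : Memℓp (fun y => f (e y)) 2 := by
  have h2 : 0 < (2 : ENNReal).toReal := by norm_num
  rw [memℓp_gen_iff h2] at hf ⊢
  exact Summable.comp_injective hf he

/-- The unitary operator `w ↦ (x ↦ w (g⁻¹ • x))` on `ℓ²(X)`. -/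
noncomputable def lpTranslate (g : G) :
    lp (fun _ : X => ℂ) 2 ≃ₗᵢ[ℂ] lp (fun _ : X => ℂ) 2 where
  toFun w := ⟨fun x => w (g⁻¹ • x), (lp.memℓp w).comp_injective (MulAction.injective g⁻¹)⟩
  invFun w := ⟨fun x => w (g • x), (lp.memℓp w).comp_injective (MulAction.injective g)⟩
  map_add' _ _ := rfl
  map_smul' _ _ := rfl
  left_inv w := by ext x; simp
  right_inv w := by ext x; simp
  norm_map' w := by
    have h2 : 0 < (2 : ENNReal).toReal := by norm_num
    rw [lp.norm_eq_tsum_rpow h2, lp.norm_eq_tsum_rpow h2]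
    congr 1
    exact (MulAction.toPerm g⁻¹).tsum_eq (fun x => ‖w x‖ ^ (2 : ENNReal).toReal)

variable (G X) in
/-- The permutation representation of `G` on `ℓ²(X)` attached to an action of `G` on `X`. -/
noncomputable def permutationRep : G →* (lp (fun _ : X => ℂ) 2 ≃ₗᵢ[ℂ] lp (fun _ : X => ℂ) 2) where
  toFun := lpTranslate
  map_one' := by
    ext w x
    change w ((1 : G)⁻¹ • x) = w x
    simp
  map_mul' g h := by
    ext w x
    change w ((g * h)⁻¹ • x) = w (h⁻¹ • g⁻¹ • x)
    rw [mul_inv_rev, mul_smul]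

theorem permutationRep_apply (g : G) (w : lp (fun _ : X => ℂ) 2) (x : X) :
    permutationRep G X g w x = w (g⁻¹ • x) := rfl

/-- If some `g` has only infinite orbits, the permutation representation has no non-zero finite
dimensional subrepresentation: the modulus of an eigenvector of `g` is constant on each orbit
of `g`, which is impossible for a non-zero square-summable function. -/
theorem permutationRep_invariant_eq_bot (g : G)
    (hg : ∀ x : X, Function.Injective fun n : ℕ => g ^ n • x)
    (W : Submodule ℂ (lp (fun _ : X => ℂ) 2)) [FiniteDimensional ℂ W]
    (hW : ∀ w ∈ W, permutationRep G X g w ∈ W) : W = ⊥ := by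
  by_contra hne
  have : Nontrivial W := Submodule.nontrivial_iff_ne_bot.2 hne
  let T : Module.End ℂ W := (permutationRep G X g).toLinearEquiv.toLinearMap.restrict hW
  obtain ⟨c, hc⟩ := Module.End.exists_eigenvalue T
  obtain ⟨w, hw⟩ := hc.exists_hasEigenvector
  have hTw : permutationRep G X g (w : lp (fun _ : X => ℂ) 2) = c • (w : lp (fun _ : X => ℂ) 2) :=
    congrArg Subtype.val hw.apply_eq_smul
  have hw0 : (w : lp (fun _ : X => ℂ) 2) ≠ 0 := fun h => hw.2 (Subtype.ext h)
  have hc1 : ‖c‖ = 1 := by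
    have h := congrArg norm hTw
    rw [LinearIsometryEquiv.norm_map, norm_smul] at h
    have : ‖(w : lp (fun _ : X => ℂ) 2)‖ ≠ 0 := norm_ne_zero_iff.2 hw0
    field_simp at h
    exact h.symm
  have hstep : ∀ x : X, ‖(w : lp (fun _ : X => ℂ) 2) (g • x)‖ =
      ‖(w : lp (fun _ : X => ℂ) 2) x‖ := fun x => by
    have h := congrArg (fun u : lp (fun _ : X => ℂ) 2 => ‖u (g • x)‖) hTw
    simp only [permutationRep_apply, inv_smul_smul, lp.coeFn_smul, Pi.smul_apply, norm_smul,
      hc1, one_mul] at h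
    exact h.symm
  have horbit : ∀ (x : X) (n : ℕ), ‖(w : lp (fun _ : X => ℂ) 2) (g ^ n • x)‖ =
      ‖(w : lp (fun _ : X => ℂ) 2) x‖ := fun x n => by
    induction n with
    | zero => simp
    | succ n ih => rw [pow_succ', mul_smul, hstep, ih]
  apply hw0
  ext x
  have hs := ((lp.memℓp (w : lp (fun _ : X => ℂ) 2)).comp_injective (hg x)).summable
    (by norm_num)
  simp only [horbit] at hs
  have := (summable_const_iff _).1 hs
  simpa using this

/-- The cocycle `g ↦ v - g v` of a function `v` on `X`, not necessarily in `ℓ²(X)`, all of whose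
differences `v - g v` are square-summable. -/
noncomputable def formalCoboundary (v : X → ℂ)
    (hv : ∀ g : G, Memℓp (fun x => v x - v (g⁻¹ • x)) 2) : cocycles (permutationRep G X) :=
  ⟨fun g => ⟨fun x => v x - v (g⁻¹ • x), hv g⟩, fun g h => by
    ext x
    change v x - v ((g * h)⁻¹ • x) =
      (v x - v (g⁻¹ • x)) + (v (g⁻¹ • x) - v (h⁻¹ • g⁻¹ • x))
    rw [mul_inv_rev, mul_smul]
    ring⟩

/-- Square-summability of `v - g v` need only be checked on generators. -/
theorem memℓp_sub_smul_of_mem_closure (v : X → ℂ) {S : Set G}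
    (hS : ∀ g ∈ S, Memℓp (fun x => v x - v (g⁻¹ • x)) 2) {g : G}
    (hg : g ∈ Subgroup.closure S) : Memℓp (fun x => v x - v (g⁻¹ • x)) 2 := by
  induction hg using Subgroup.closure_induction with
  | mem g hg => exact hS g hg
  | one =>
    convert (zero_memℓp : Memℓp (0 : X → ℂ) 2) using 1
    ext x
    simp
  | mul g h _ _ hg hh =>
    convert hg.add (hh.comp_injective (MulAction.injective g⁻¹)) using 1
    ext x
    simp [mul_smul]
  | inv g _ hg =>
    convert (hg.comp_injective (MulAction.injective g)).neg using 1
    ext x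
    simp

/-- Orthogonality of a finite family of `ℓ²` vectors, viewed as a flow on the Schreier graph of
the action, to all coboundaries: this is the condition that the flow is free of divergence. -/
theorem sum_inner_sub_permutationRep {ι : Type*} [Fintype ι] (s : ι → G)
    (A : ι → lp (fun _ : X => ℂ) 2)
    (hA : ∀ x, ∑ i, (A i x - A i (s i • x)) = 0) (w : lp (fun _ : X => ℂ) 2) :
    ∑ i, inner ℂ (A i) (w - permutationRep G X (s i) w) = 0 := by
  have h1 : ∀ i, inner ℂ (A i) (w - permutationRep G X (s i) w) =
      inner ℂ (A i - (permutationRep G X (s i)).symm (A i)) w := fun i => by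
    rw [inner_sub_left, inner_sub_right, LinearIsometryEquiv.inner_map_eq_flip,
      LinearIsometryEquiv.symm_symm]
  simp only [h1]
  rw [← sum_inner]
  have : ∑ i, (A i - (permutationRep G X (s i)).symm (A i)) = 0 := by
    ext x
    rw [lp.coeFn_sum, Finset.sum_apply]
    exact hA x
  rw [this, inner_zero_left]

end PermutationRepresentation

/-! ### Detecting reduced cohomology -/

section ReducedCohomology

variable {G : Type*} [Group G] {H : Type*} [NormedAddCommGroup H] [InnerProductSpace ℂ H]

/-- A finite pairing `b ↦ ∑ ⟪A i, b (s i)⟫` that vanishes on coboundaries is continuous for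
pointwise convergence, so it detects non-zero reduced classes. -/
theorem nontrivial_reducedH1_of_pairing {π : G →* (H ≃ₗᵢ[ℂ] H)} {ι : Type*} [Fintype ι]
    (s : ι → G) (A : ι → H) (hA : ∀ w : H, ∑ i, inner ℂ (A i) (w - π (s i) w) = 0)
    (b : cocycles π) (hb : ∑ i, inner ℂ (A i) ((b : G → H) (s i)) ≠ 0) :
    Nontrivial (ReducedH1 π) := by
  rw [Submodule.Quotient.nontrivial_iff]
  intro htop
  have hcl : IsClosed {β : cocycles π | ∑ i, inner ℂ (A i) ((β : G → H) (s i)) = 0} := by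
    refine isClosed_eq (continuous_finsetSum _ fun i _ => ?_) continuous_const
    exact continuous_const.inner ((continuous_apply (s i)).comp continuous_subtype_val)
  have hsub : ((coboundaries π : Submodule ℂ (cocycles π)) : Set (cocycles π)) ⊆
      {β : cocycles π | ∑ i, inner ℂ (A i) ((β : G → H) (s i)) = 0} := by
    rintro β ⟨w, hw⟩
    change ∑ i, inner ℂ (A i) ((β : G → H) (s i)) = 0
    simp only [hw]
    exact hA w
  have hmem : b ∈ (coboundaries π).topologicalClosure := htop ▸ Submodule.mem_top
  exact hb (closure_minimal hsub hcl hmem)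

end ReducedCohomology

/-! ### Averages over a transitive action -/

/-- Averaging over a transitive group is averaging over the set it acts on. -/
theorem card_mul_sum_smul_of_isPretransitive {F α : Type*} [Group F] [Fintype F] [Fintype α]
    [MulAction F α] [MulAction.IsPretransitive F α] (ψ : α → ℂ) (i : α) :
    (Fintype.card α : ℂ) * ∑ f : F, ψ (f • i) = Fintype.card F * ∑ j, ψ j := by
  have hconst : ∀ j, ∑ f : F, ψ (f • j) = ∑ f : F, ψ (f • i) := fun j => by
    obtain ⟨g, rfl⟩ := MulAction.exists_smul_eq F i j
    simp only [← mul_smul]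
    exact Equiv.sum_comp (Equiv.mulRight g) fun f => ψ (f • i)
  calc (Fintype.card α : ℂ) * ∑ f : F, ψ (f • i)
      = ∑ j, ∑ f : F, ψ (f • j) := by simp [hconst]
    _ = ∑ f : F, ∑ j, ψ (f • j) := Finset.sum_comm
    _ = ∑ _f : F, ∑ j, ψ j :=
        Finset.sum_congr rfl fun f _ => Equiv.sum_comp (MulAction.toPerm f) ψ
    _ = Fintype.card F * ∑ j, ψ j := by simp

/-- The function `q • 1_{0} - 1` on the alphabet, which has mean zero. -/
noncomputable def centeredDirac {q : ℕ} [NeZero q] (i : Fin q) : ℂ :=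
  (if i = 0 then (q : ℂ) else 0) - 1

section CenteredDirac

variable {q : ℕ} [NeZero q]

theorem sum_centeredDirac : ∑ i : Fin q, centeredDirac i = 0 := by
  simp [centeredDirac]

theorem conj_centeredDirac (i : Fin q) :
    (starRingEnd ℂ) (centeredDirac i) = centeredDirac i := by
  unfold centeredDirac
  split_ifs <;> simp

theorem norm_centeredDirac_le (i : Fin q) : ‖centeredDirac i‖ ≤ q + 1 := by
  unfold centeredDirac
  refine (norm_sub_le _ _).trans ?_
  split_ifs <;> simp

theorem sum_centeredDirac_mul_self :
    ∑ i : Fin q, centeredDirac i * centeredDirac i = q * (q - 1) := by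
  have h : ∀ i : Fin q, centeredDirac i * centeredDirac i =
      (if i = 0 then (q : ℂ) * (q - 2) else 0) + 1 := fun i => by
    unfold centeredDirac
    split_ifs <;> ring
  simp only [h, Finset.sum_add_distrib]
  simp
  ring

theorem sum_centeredDirac_smul {F : Type*} [Group F] [Fintype F] [MulAction F (Fin q)]
    [MulAction.IsPretransitive F (Fin q)] (i : Fin q) :
    ∑ f : F, centeredDirac (f • i) = 0 := by
  have h := card_mul_sum_smul_of_isPretransitive (F := F) centeredDirac i
  rw [sum_centeredDirac, mul_zero, Fintype.card_fin] at h
  exact (mul_eq_zero.1 h).resolve_left (Nat.cast_ne_zero.2 (NeZero.ne q))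

theorem card_mul_sum_ite_smul_eq_zero {F : Type*} [Group F] [Fintype F] [MulAction F (Fin q)]
    [MulAction.IsPretransitive F (Fin q)] (i : Fin q) (c : ℂ) :
    (q : ℂ) * ∑ f : F, (if f • i = 0 then c else 0) = Fintype.card F * c := by
  have h := card_mul_sum_smul_of_isPretransitive (F := F)
    (fun j : Fin q => if j = 0 then c else 0) i
  simpa using h

end CenteredDirac

/-! ### A square-summable flow without divergence -/

namespace TreeVertex

variable {q : ℕ} [NeZero q]

theorem isBelow_translate_one_iff (x : TreeVertex q) :
    (translate 1 x).IsBelow ↔ x.IsBelow ∧ x.level ≠ -1 ∧ x.label (-1) = 0 := by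
  constructor
  · rintro ⟨h1, h2⟩
    simp only [translate] at h1 h2
    refine ⟨⟨by omega, fun k hk => ?_⟩, by omega, ?_⟩
    · simpa using h2 (k + 1) (by omega)
    · simpa using h2 0 le_rfl
  · rintro ⟨⟨h1, h2⟩, h3, h4⟩
    refine ⟨by simp only [translate]; omega, fun k hk => ?_⟩
    simp only [translate]
    rcases eq_or_lt_of_le hk with rfl | hk
    · simpa using h4
    · exact h2 _ (by omega)

theorem ray_zero_child_isBelow (i : Fin q) : ((ray q 0).child i).IsBelow := by
  refine ⟨by simp [child, ray], fun k hk => ?_⟩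
  simp only [child, ray]
  rw [Function.update_of_ne (by omega)]

theorem eq_ray_zero_child (x : TreeVertex q) (hx : x.IsBelow) (h : x.level = -1) :
    (ray q 0).child (x.label (-1)) = x := by
  ext1
  · simp [child, ray, h]
  · funext k
    simp only [child, ray, zero_sub]
    rcases lt_trichotomy k (-1) with hk | rfl | hk
    · rw [Function.update_of_ne (by omega), x.label_of_lt k (by omega)]
    · simp
    · rw [Function.update_of_ne (by omega), hx.2 k (by omega)]

/-- The label of a vertex as a child of its parent, composed with `centeredDirac`. -/
noncomputable def labelWeight (x : TreeVertex q) : ℂ := centeredDirac (x.label x.level)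

theorem labelWeight_translate (m : ℤ) (x : TreeVertex q) :
    labelWeight (translate m x) = labelWeight x := by
  simp [labelWeight, translate]

theorem labelWeight_ray_zero_child (i : Fin q) :
    labelWeight ((ray q 0).child i) = centeredDirac i := by
  simp [labelWeight, child, ray]

theorem labelWeight_permuteFun_of_level_ne {F : Type*} [Group F] [MulAction F (Fin q)] (f : F)
    (x : TreeVertex q) (h : x.level ≠ -1) : labelWeight (permuteFun f x) = labelWeight x := by
  by_cases hx : x.IsBelow
  · rw [permuteFun_of_isBelow f x hx]
    simp [labelWeight, relabel, Function.update_of_ne h]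
  · rw [permuteFun_of_not_isBelow f x hx]

theorem permuteFun_ray_zero_child {F : Type*} [Group F] [MulAction F (Fin q)] (f : F)
    (i : Fin q) : permuteFun f ((ray q 0).child i) = (ray q 0).child (f • i) :=
  treePermute_child q f i

open Classical in
/-- The intensity of the flow along the edge from `x` to its image under the inverse of the
shift. The flow lives on the strict descendants of `ray 0`; a vertex at depth `n` below `ray 0`
sends `q ^ (-n)` times its `labelWeight`. -/
noncomputable def flow (x : TreeVertex q) : ℂ :=
  if x.IsBelow then labelWeight x * (q : ℂ) ^ x.level else 0

theorem flow_of_isBelow (x : TreeVertex q) (hx : x.IsBelow) :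
    flow x = labelWeight x * (q : ℂ) ^ x.level := if_pos hx

theorem flow_of_not_isBelow (x : TreeVertex q) (hx : ¬ x.IsBelow) : flow x = 0 := if_neg hx

theorem flow_translate_one (x : TreeVertex q) (hx : x.IsBelow) (h : x.level ≠ -1) :
    flow (translate 1 x) =
      if x.label (-1) = 0 then labelWeight x * (q : ℂ) ^ (x.level + 1) else 0 := by
  split_ifs with h0
  · rw [flow_of_isBelow _ ((isBelow_translate_one_iff x).2 ⟨hx, h, h0⟩), labelWeight_translate]
    rfl
  · exact flow_of_not_isBelow _ fun hb => h0 ((isBelow_translate_one_iff x).1 hb).2.2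

/-- The divergence of the flow along the edges of the shift. -/
noncomputable def shiftDivergence (x : TreeVertex q) : ℂ := flow (translate 1 x) - flow x

theorem shiftDivergence_of_not_isBelow (x : TreeVertex q) (hx : ¬ x.IsBelow) :
    shiftDivergence x = 0 := by
  rw [shiftDivergence, flow_of_not_isBelow x hx, flow_of_not_isBelow, sub_zero]
  exact fun h => hx ((isBelow_translate_one_iff x).1 h).1

theorem shiftDivergence_ray_zero_child (i : Fin q) :
    shiftDivergence ((ray q 0).child i) = -(centeredDirac i * (q : ℂ)⁻¹) := by
  have hl : ((ray q 0).child i).level = -1 := by simp [child, ray]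
  rw [shiftDivergence, flow_of_isBelow _ (ray_zero_child_isBelow i), flow_of_not_isBelow,
    labelWeight_ray_zero_child, hl]
  · simp
  · exact fun h => ((isBelow_translate_one_iff _).1 h).2.1 hl

/-- On each orbit of the local permutations the flow that enters is the flow that leaves. At
depth one this is because `centeredDirac` has mean zero; deeper, one vertex in `q` receives a
flow, which is `q` times what each vertex emits. -/
theorem sum_shiftDivergence_permuteFun {F : Type*} [Group F] [Fintype F] [MulAction F (Fin q)]
    [MulAction.IsPretransitive F (Fin q)] (x : TreeVertex q) (hx : x.IsBelow) :
    ∑ f : F, shiftDivergence (permuteFun f x) = 0 := by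
  have hq : (q : ℂ) ≠ 0 := Nat.cast_ne_zero.2 (NeZero.ne q)
  by_cases h : x.level = -1
  · rw [← eq_ray_zero_child x hx h]
    simp only [permuteFun_ray_zero_child, shiftDivergence_ray_zero_child, Finset.sum_neg_distrib,
      ← Finset.sum_mul, sum_centeredDirac_smul, zero_mul, neg_zero]
  · have key : ∀ f : F, shiftDivergence (permuteFun f x) =
        (if f • x.label (-1) = 0 then labelWeight x * (q : ℂ) ^ (x.level + 1) else 0) -
          labelWeight x * (q : ℂ) ^ x.level := fun f => by
      have hb := x.relabel_isBelow hx (f • x.label (-1))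
      have hw := labelWeight_permuteFun_of_level_ne f x h
      rw [permuteFun_of_isBelow f x hx] at hw ⊢
      rw [shiftDivergence, flow_of_isBelow _ hb, flow_translate_one _ hb h, hw]
      simp [relabel]
    simp only [key, Finset.sum_sub_distrib]
    rw [sub_eq_zero]
    apply mul_left_cancel₀ hq
    rw [card_mul_sum_ite_smul_eq_zero, zpow_add_one₀ hq]
    simp only [Finset.sum_const, Finset.card_univ, nsmul_eq_mul]
    ring

/-- A strict descendant of `ray 0`, encoded by its depth and its labels. -/
def belowCode (x : {x : TreeVertex q // x.IsBelow}) : Σ m : ℕ, (Fin m → Fin q) :=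
  ⟨(-x.1.level).toNat, fun j => x.1.label (-1 - j)⟩

theorem belowCode_injective : Function.Injective (belowCode (q := q)) := by
  rintro ⟨x, hx⟩ ⟨y, hy⟩ h
  have hl : x.level = y.level := by
    have h1 := congrArg Sigma.fst h
    have hx1 := hx.1
    have hy1 := hy.1
    simp only [belowCode] at h1
    omega
  have hd : ∀ k : ℕ, (k : ℤ) < -x.level → x.label (-1 - k) = y.label (-1 - k) := fun k hk => by
    have h1 := congrArg (fun s : Σ m : ℕ, (Fin m → Fin q) =>
      if h : k < s.1 then s.2 ⟨k, h⟩ else 0) h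
    have hkx : k < (belowCode ⟨x, hx⟩).1 := by change k < (-x.level).toNat; omega
    have hky : k < (belowCode ⟨y, hy⟩).1 := by change k < (-y.level).toNat; omega
    exact (dif_pos hkx).symm.trans (h1.trans (dif_pos hky))
  refine Subtype.ext (TreeVertex.ext hl (funext fun k => ?_))
  by_cases hk0 : 0 ≤ k
  · rw [hx.2 k hk0, hy.2 k hk0]
  by_cases hk : k < x.level
  · rw [x.label_of_lt k hk, y.label_of_lt k (hl ▸ hk)]
  · have := hd (-1 - k).toNat (by omega)
    rwa [show -1 - (((-1 - k).toNat : ℕ) : ℤ) = k by omega] at this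

/-- There are `q ^ n` strict descendants of `ray 0` at depth `n`, each carrying a flow of order
`q ^ (-n)`, so the energy is a geometric series. -/
theorem memℓp_flow (hq : 2 ≤ q) : Memℓp (flow (q := q)) 2 := by
  have hq0 : (0 : ℝ) < q := Nat.cast_pos.2 (NeZero.pos q)
  apply memℓp_gen
  have hcode : Summable fun s : Σ m : ℕ, (Fin m → Fin q) =>
      ((q : ℝ) + 1) ^ 2 * (((q : ℝ)⁻¹) ^ s.1) ^ 2 := by
    rw [summable_sigma_of_nonneg fun s => by positivity]
    refine ⟨fun m => Summable.of_finite, ?_⟩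
    have hgeom : Summable fun m : ℕ => ((q : ℝ) + 1) ^ 2 * ((q : ℝ)⁻¹) ^ m := by
      refine (summable_geometric_of_lt_one (by positivity) ?_).mul_left _
      rw [inv_lt_one₀ hq0]
      exact_mod_cast hq
    refine hgeom.congr fun m => ?_
    simp only [tsum_fintype, Finset.sum_const, Finset.card_univ, Fintype.card_fun,
      Fintype.card_fin, nsmul_eq_mul, Nat.cast_pow, inv_pow]
    field_simp
  have hbelow := hcode.comp_injective (belowCode_injective (q := q))
  have hsub : Summable ((fun x : TreeVertex q => ‖flow x‖ ^ (2 : ENNReal).toReal) ∘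
      ((↑) : {x : TreeVertex q | x.IsBelow} → TreeVertex q)) := by
    refine Summable.of_nonneg_of_le (fun x => Real.rpow_nonneg (norm_nonneg _) _)
      (fun x => ?_) hbelow
    obtain ⟨x, hx⟩ := x
    have hx1 : x.IsBelow := hx
    have hpow : (q : ℝ) ^ x.level = ((q : ℝ)⁻¹) ^ (-x.level).toNat := by
      have h0 := hx1.1
      rw [inv_pow, ← zpow_natCast, ← zpow_neg]
      congr 1
      omega
    simp only [Function.comp_apply, ENNReal.toReal_ofNat, Real.rpow_ofNat, belowCode]
    rw [← mul_pow]
    refine pow_le_pow_left₀ (norm_nonneg _) ?_ 2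
    rw [flow_of_isBelow x hx1, norm_mul, norm_zpow, Complex.norm_natCast, hpow]
    exact mul_le_mul_of_nonneg_right (norm_centeredDirac_le _) (by positivity)
  rw [summable_subtype_iff_indicator] at hsub
  refine hsub.congr fun x => ?_
  by_cases hx : x.IsBelow
  · exact Set.indicator_of_mem (s := {x : TreeVertex q | x.IsBelow}) hx _
  · rw [Set.indicator_of_notMem (s := {x : TreeVertex q | x.IsBelow}) hx,
      flow_of_not_isBelow x hx]
    simp

theorem memℓp_shiftDivergence (hq : 2 ≤ q) : Memℓp (shiftDivergence (q := q)) 2 := by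
  have h : Function.Injective (translate 1 : TreeVertex q → TreeVertex q) :=
    (treeShift q).injective
  exact ((memℓp_flow hq).comp_injective h).sub (memℓp_flow hq)

end TreeVertex

/-! ### Failure of property `H_FD` -/

namespace TreeVertex

variable {q : ℕ} [NeZero q]

theorem labelWeight_sub_permuteFun_eq_zero {F : Type*} [Group F] [MulAction F (Fin q)] (f : F)
    (x : TreeVertex q) (hx : x ∉ Set.range (ray q 0).child) :
    labelWeight x - labelWeight (permuteFun f x) = 0 := by
  by_cases hb : x.IsBelow
  · have h : x.level ≠ -1 := fun h => hx ⟨_, eq_ray_zero_child x hb h⟩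
    rw [labelWeight_permuteFun_of_level_ne f x h, sub_self]
  · rw [permuteFun_of_not_isBelow f x hb, sub_self]

/-- The difference is supported on the finitely many children of `ray 0`. -/
theorem memℓp_labelWeight_sub_permuteFun {F : Type*} [Group F] [MulAction F (Fin q)] (f : F) :
    Memℓp (fun x : TreeVertex q => labelWeight x - labelWeight (permuteFun f x)) 2 := by
  refine (memℓp_zero ((Set.finite_range (ray q 0).child).subset fun x hx => ?_)).of_exponent_ge
    zero_le
  by_contra h
  exact hx (labelWeight_sub_permuteFun_eq_zero f x h)

theorem ray_zero_child_injective : Function.Injective (ray q 0).child := fun i j h => by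
  have := congrFun (congrArg label h) (-1)
  simpa [child, ray] using this

end TreeVertex

section DiscreteAffineGroup

open TreeVertex hiding translate translate_translate

variable (q : ℕ) [NeZero q] (F : Type*) [Group F] [MulAction F (Fin q)]

theorem treeShift_mem : treeShift q ∈ discreteAffineGroup q F :=
  Subgroup.subset_closure (Set.mem_insert _ _)

theorem treePermute_mem (f : F) : treePermute q f ∈ discreteAffineGroup q F :=
  Subgroup.subset_closure (Set.mem_insert_of_mem _ ⟨f, rfl⟩)

/-- The generators of the discrete affine group: `none` stands for the shift, `some f` for the
local permutation by `f`. -/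
noncomputable def affineGenerator : Option F → discreteAffineGroup q F
  | none => ⟨treeShift q, treeShift_mem q F⟩
  | some f => ⟨treePermute q f, treePermute_mem q F f⟩

theorem memℓp_labelWeight_sub_smul (g : discreteAffineGroup q F) :
    Memℓp (fun x : TreeVertex q => labelWeight x - labelWeight (g⁻¹ • x)) 2 := by
  refine memℓp_sub_smul_of_mem_closure labelWeight (S := insert (treeShift q)
    (Set.range fun f : F => treePermute q f)) ?_ g.2
  rintro _ (rfl | ⟨f, rfl⟩)
  · convert (zero_memℓp : Memℓp (0 : TreeVertex q → ℂ) 2) using 1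
    ext x
    change labelWeight x - labelWeight (TreeVertex.translate (-1) x) = 0
    rw [labelWeight_translate, sub_self]
  · exact memℓp_labelWeight_sub_permuteFun f⁻¹

/-- The cocycle of the formal coboundary of `labelWeight`. It vanishes on the shift. -/
noncomputable def labelCocycle :
    cocycles (permutationRep (discreteAffineGroup q F) (TreeVertex q)) :=
  formalCoboundary labelWeight (memℓp_labelWeight_sub_smul q F)

variable {q}

/-- The flow of `TreeVertex.flow` along the shift, balanced along the local permutations: each
of them carries away the same share of the divergence. -/
noncomputable def affineFlow [Fintype F] (hq : 2 ≤ q) :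
    Option F → lp (fun _ : TreeVertex q => ℂ) 2
  | none => ⟨flow, memℓp_flow hq⟩
  | some _ => (Fintype.card F : ℂ)⁻¹ • ⟨shiftDivergence, memℓp_shiftDivergence hq⟩

theorem affineFlow_divergence [Fintype F] [MulAction.IsPretransitive F (Fin q)] (hq : 2 ≤ q)
    (x : TreeVertex q) :
    ∑ i, (affineFlow F hq i x - affineFlow F hq i (affineGenerator q F i • x)) = 0 := by
  have hF : (Fintype.card F : ℂ) ≠ 0 := Nat.cast_ne_zero.2 Fintype.card_ne_zero
  rw [Fintype.sum_option]
  change flow x - flow (TreeVertex.translate 1 x) + ∑ f : F,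
    ((Fintype.card F : ℂ)⁻¹ * shiftDivergence x -
      (Fintype.card F : ℂ)⁻¹ * shiftDivergence (permuteFun f x)) = 0
  by_cases hx : x.IsBelow
  · rw [Finset.sum_sub_distrib, ← Finset.mul_sum, ← Finset.mul_sum,
      sum_shiftDivergence_permuteFun x hx]
    simp only [Finset.sum_const, Finset.card_univ, nsmul_eq_mul]
    rw [inv_mul_cancel_left₀ hF, shiftDivergence]
    ring
  · have h := shiftDivergence_of_not_isBelow x hx
    simp only [permuteFun_of_not_isBelow _ x hx, h]
    rw [shiftDivergence] at h
    simp only [mul_zero, sub_zero, Finset.sum_const_zero, add_zero]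
    linear_combination -h

theorem inner_affineFlow_labelCocycle [Fintype F] (hq : 2 ≤ q) (f : F) :
    inner ℂ (affineFlow F hq (some f))
      ((labelCocycle q F : discreteAffineGroup q F → lp (fun _ : TreeVertex q => ℂ) 2)
        (affineGenerator q F (some f))) =
      -((Fintype.card F : ℂ)⁻¹ * (q : ℂ)⁻¹ *
        ∑ i : Fin q, centeredDirac i * (centeredDirac i - centeredDirac (f⁻¹ • i))) := by
  rw [lp.inner_eq_tsum]
  have hterm : ∀ x : TreeVertex q, inner ℂ (affineFlow F hq (some f) x)
      ((labelCocycle q F : discreteAffineGroup q F → lp (fun _ : TreeVertex q => ℂ) 2)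
        (affineGenerator q F (some f)) x) =
      (labelWeight x - labelWeight (permuteFun f⁻¹ x)) *
        (starRingEnd ℂ) ((Fintype.card F : ℂ)⁻¹ * shiftDivergence x) := fun x => rfl
  simp only [hterm]
  rw [← (ray_zero_child_injective (q := q)).tsum_eq, tsum_fintype, Finset.mul_sum,
    ← Finset.sum_neg_distrib]
  · refine Finset.sum_congr rfl fun i _ => ?_
    rw [permuteFun_ray_zero_child, shiftDivergence_ray_zero_child]
    simp only [labelWeight_ray_zero_child, map_mul, map_neg, map_inv₀, conj_centeredDirac,
      map_natCast]
    ring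
  · intro x hx
    by_contra h
    exact hx (by simp only [labelWeight_sub_permuteFun_eq_zero f⁻¹ x h, zero_mul])

theorem sum_inner_affineFlow_labelCocycle [Fintype F] [MulAction.IsPretransitive F (Fin q)]
    (hq : 2 ≤ q) :
    ∑ i, inner ℂ (affineFlow F hq i)
      ((labelCocycle q F : discreteAffineGroup q F → lp (fun _ : TreeVertex q => ℂ) 2)
        (affineGenerator q F i)) = 1 - q := by
  have hF : (Fintype.card F : ℂ) ≠ 0 := Nat.cast_ne_zero.2 Fintype.card_ne_zero
  have hq0 : (q : ℂ) ≠ 0 := Nat.cast_ne_zero.2 (NeZero.ne q)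
  have hshift : (labelCocycle q F : discreteAffineGroup q F → lp (fun _ : TreeVertex q => ℂ) 2)
      (affineGenerator q F none) = 0 := by
    ext x
    change labelWeight x - labelWeight (TreeVertex.translate (-1) x) = 0
    rw [labelWeight_translate, sub_self]
  have hinv : ∀ i : Fin q, ∑ f : F, centeredDirac (f⁻¹ • i) = 0 := fun i =>
    (Equiv.sum_comp (Equiv.inv F) fun f => centeredDirac (f • i)).trans (sum_centeredDirac_smul i)
  rw [Fintype.sum_option, hshift, inner_zero_right, zero_add]
  simp only [inner_affineFlow_labelCocycle]
  rw [Finset.sum_neg_distrib, ← Finset.mul_sum, Finset.sum_comm]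
  have hsum : ∀ i : Fin q,
      ∑ f : F, centeredDirac i * (centeredDirac i - centeredDirac (f⁻¹ • i)) =
        Fintype.card F * (centeredDirac i * centeredDirac i) := fun i => by
    rw [← Finset.mul_sum, Finset.sum_sub_distrib, hinv]
    simp only [Finset.sum_const, Finset.card_univ, nsmul_eq_mul]
    ring
  simp only [hsum]
  rw [← Finset.mul_sum, sum_centeredDirac_mul_self]
  field_simp
  ring

theorem level_treeShift_pow (n : ℕ) (x : TreeVertex q) :
    (((affineGenerator q F none) ^ n • x : TreeVertex q)).level = x.level + n := by
  induction n with
  | zero => simp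
  | succ n ih =>
    rw [pow_succ', mul_smul]
    change ((affineGenerator q F none) ^ n • x : TreeVertex q).level + 1 = _
    rw [ih]
    push_cast
    ring

theorem not_hasPropertyHFD_discreteAffineGroup [Finite F] [MulAction.IsPretransitive F (Fin q)]
    (hq : 2 ≤ q) : ¬ HasPropertyHFD (discreteAffineGroup q F) := by
  intro hHFD
  have := Fintype.ofFinite F
  have hq1 : (1 : ℂ) - q ≠ 0 := by
    rw [sub_ne_zero]
    exact_mod_cast (by omega : 1 ≠ q)
  obtain ⟨W, hW, hfin, hinv⟩ := hHFD (lp (fun _ : TreeVertex q => ℂ) 2)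
    (permutationRep (discreteAffineGroup q F) (TreeVertex q))
    (nontrivial_reducedH1_of_pairing (affineGenerator q F) (affineFlow F hq)
      (sum_inner_sub_permutationRep _ _ (affineFlow_divergence F hq)) (labelCocycle q F)
      (by rw [sum_inner_affineFlow_labelCocycle]; exact hq1))
  refine hW (permutationRep_invariant_eq_bot (affineGenerator q F none) (fun x m n h => ?_) W
    (hinv _))
  have h1 := congrArg level h
  simp only [level_treeShift_pow] at h1
  omega

/-! ### Finite generation and local finiteness -/

theorem fg_discreteAffineGroup [Finite F] : Group.FG (discreteAffineGroup q F) := by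
  rw [Group.fg_iff_subgroup_fg, Subgroup.fg_iff]
  exact ⟨_, rfl, (Set.finite_range _).insert _⟩

/-- `x` is not a strict descendant of `ray N`. -/
def TreeVertex.IsOutside (N : ℤ) (x : TreeVertex q) : Prop :=
  N ≤ x.level ∨ ∃ k ≥ N, x.label k ≠ 0

/-- The automorphism `g` moves all levels by `c`, coincides with the translation by `c` outside
the subtree of the strict descendants of `ray N`, and translates the labels at all positions
below `-N`. -/
structure IsTranslationOutside (N c : ℤ) (g : regularTree q ≃g regularTree q) : Prop where
  level_apply : ∀ x, (g x).level = x.level + c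
  parent_apply : ∀ x, g (parent x) = parent (g x)
  apply_of_isOutside : ∀ x, x.IsOutside N → g x = TreeVertex.translate c x
  label_apply : ∀ x, ∀ k < -N, (g x).label (k + c) = x.label k

theorem TreeVertex.IsOutside.mono {M N : ℤ} (h : M ≤ N) {x : TreeVertex q}
    (hx : x.IsOutside N) : x.IsOutside M :=
  hx.imp (fun h1 => h.trans h1) fun ⟨k, hk, h1⟩ => ⟨k, h.trans hk, h1⟩

theorem TreeVertex.IsOutside.translate {N : ℤ} (c : ℤ) {x : TreeVertex q}
    (hx : x.IsOutside N) : (TreeVertex.translate c x).IsOutside (N + c) := by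
  refine hx.imp (fun h1 => ?_) fun ⟨k, hk, h1⟩ => ⟨k + c, by omega, ?_⟩
  · simpa [TreeVertex.translate] using h1
  · simpa [TreeVertex.translate] using h1

namespace IsTranslationOutside

variable {N M c d : ℤ} {g h : regularTree q ≃g regularTree q}

theorem mono (hg : IsTranslationOutside N c g) (hNM : N ≤ M) : IsTranslationOutside M c g where
  level_apply := hg.level_apply
  parent_apply := hg.parent_apply
  apply_of_isOutside x hx := hg.apply_of_isOutside x (hx.mono hNM)
  label_apply x k hk := hg.label_apply x k (by omega)

theorem one : IsTranslationOutside N 0 (1 : regularTree q ≃g regularTree q) where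
  level_apply x := by simp
  parent_apply x := by simp
  apply_of_isOutside x _ := by ext1 <;> simp [TreeVertex.translate]
  label_apply x k _ := by simp

theorem mul (hg : IsTranslationOutside N c g) (hh : IsTranslationOutside N d h) :
    IsTranslationOutside (N + |d|) (d + c) (g * h) where
  level_apply x := by
    rw [RelIso.mul_apply, hg.level_apply, hh.level_apply, add_assoc]
  parent_apply x := by
    simp only [RelIso.mul_apply, hg.parent_apply, hh.parent_apply]
  apply_of_isOutside x hx := by
    have h1 := abs_nonneg d
    have h2 := neg_abs_le d
    rw [RelIso.mul_apply, hh.apply_of_isOutside x (hx.mono (by omega)),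
      hg.apply_of_isOutside _ ((hx.translate d).mono (by omega))]
    ext1
    · simp only [TreeVertex.translate]
      omega
    · funext k
      simp only [TreeVertex.translate]
      congr 1
      omega
  label_apply x k hk := by
    have h1 := abs_nonneg d
    have h2 := le_abs_self d
    rw [RelIso.mul_apply, ← add_assoc, hg.label_apply _ _ (by omega),
      hh.label_apply _ _ (by omega)]

theorem inv (hg : IsTranslationOutside N c g) :
    IsTranslationOutside (N + |c|) (-c) g⁻¹ where
  level_apply x := by
    have h := hg.level_apply (g⁻¹ x)
    rw [RelIso.apply_inv_self] at h
    omega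
  parent_apply x := by
    apply g.injective
    rw [hg.parent_apply, RelIso.apply_inv_self, RelIso.apply_inv_self]
  apply_of_isOutside x hx := by
    have h2 := le_abs_self c
    apply g.injective
    rw [RelIso.apply_inv_self,
      hg.apply_of_isOutside _ ((hx.translate (-c)).mono (by omega)),
      TreeVertex.translate_translate _ _ (by omega)]
  label_apply x k hk := by
    have h2 := neg_abs_le c
    have h := hg.label_apply (g⁻¹ x) (k + -c) (by omega)
    rw [RelIso.apply_inv_self] at h
    rw [← h, neg_add_cancel_right]

theorem treeShift : IsTranslationOutside 0 1 (treeShift q) where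
  level_apply _ := rfl
  parent_apply := translate_parent 1
  apply_of_isOutside _ _ := rfl
  label_apply x k _ := by
    change x.label (k + 1 - 1) = x.label k
    simp

theorem treePermute {F : Type*} [Group F] [MulAction F (Fin q)] (f : F) :
    IsTranslationOutside 1 0 (treePermute q f) where
  level_apply x := by
    change (permuteFun f x).level = _
    unfold permuteFun
    split_ifs <;> simp [relabel]
  parent_apply := permuteFun_parent f
  apply_of_isOutside x hx := by
    have hb : ¬ x.IsBelow := by
      rintro ⟨h1, h2⟩
      rcases hx with h | ⟨k, hk, h⟩
      · omega
      · exact h (h2 k (by omega))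
    refine (permuteFun_of_not_isBelow f x hb).trans ?_
    ext1 <;> simp [TreeVertex.translate]
  label_apply x k hk := by
    change (permuteFun f x).label (k + 0) = _
    unfold permuteFun
    split_ifs
    · simp only [relabel, add_zero]
      rw [Function.update_of_ne (by omega)]
    · simp

theorem exists_of_mem {F : Type*} [Group F] [MulAction F (Fin q)]
    (hg : g ∈ discreteAffineGroup q F) : ∃ N c, IsTranslationOutside N c g := by
  induction hg using Subgroup.closure_induction with
  | mem g hg =>
    rcases hg with rfl | ⟨f, rfl⟩
    · exact ⟨0, 1, treeShift⟩
    · exact ⟨1, 0, treePermute f⟩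
  | one => exact ⟨0, 0, one⟩
  | mul g h _ _ hg hh =>
    obtain ⟨N, c, hg⟩ := hg
    obtain ⟨M, d, hh⟩ := hh
    exact ⟨_, _, (hg.mono (le_max_left N M)).mul (hh.mono (le_max_right N M))⟩
  | inv g _ hg =>
    obtain ⟨N, c, hg⟩ := hg
    exact ⟨_, _, hg.inv⟩

end IsTranslationOutside

variable (q)

/-- The group of automorphisms that fix all vertices except the strict descendants of `ray N`,
and preserve all labels at positions below `-N`. -/
def boundedSupportSubgroup (N : ℤ) : Subgroup (regularTree q ≃g regularTree q) where
  carrier := {g | IsTranslationOutside N 0 g}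
  mul_mem' hg hh := by simpa using IsTranslationOutside.mul hg hh
  one_mem' := IsTranslationOutside.one
  inv_mem' hg := by simpa using IsTranslationOutside.inv hg

/-- The descendants of `ray N` at level `-N`. -/
def window (N : ℤ) : Set (TreeVertex q) := {x | x.level = -N ∧ ∀ k ≥ N, x.label k = 0}

theorem finite_window (N : ℤ) : (window q N).Finite := by
  have hinj : Function.Injective fun (x : window q N) (k : Set.Ico (-N) N) => x.1.label k := by
    rintro ⟨x, hx, hx'⟩ ⟨y, hy, hy'⟩ h
    refine Subtype.ext (TreeVertex.ext (hx.trans hy.symm) (funext fun k => ?_))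
    by_cases h1 : N ≤ k
    · rw [hx' k h1, hy' k h1]
    by_cases h2 : k < -N
    · rw [x.label_of_lt k (hx ▸ h2), y.label_of_lt k (hy ▸ h2)]
    · exact congrFun h ⟨k, by simp only [Set.mem_Ico]; omega⟩
  exact Set.finite_coe_iff.1 (Finite.of_injective _ hinj)

variable {q}

theorem TreeVertex.level_parent_iterate (n : ℕ) (x : TreeVertex q) :
    (parent^[n] x).level = x.level + n := by
  induction n with
  | zero => simp
  | succ n ih =>
    rw [Function.iterate_succ_apply']
    change (parent^[n] x).level + 1 = _
    rw [ih]
    push_cast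
    ring

theorem TreeVertex.label_parent_iterate (n : ℕ) (x : TreeVertex q) (k : ℤ)
    (hk : x.level + n ≤ k) : (parent^[n] x).label k = x.label k := by
  induction n with
  | zero => simp
  | succ n ih =>
    push_cast at hk
    rw [Function.iterate_succ_apply']
    change Function.update (parent^[n] x).label (parent^[n] x).level 0 k = _
    rw [level_parent_iterate, Function.update_of_ne (by omega), ih (by omega)]

namespace IsTranslationOutside

variable {N : ℤ} {g h : regularTree q ≃g regularTree q}

/-- An image outside the window would be a vertex fixed by `g`, hence its own preimage. -/
theorem mapsTo_window (hg : IsTranslationOutside N 0 g) :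
    Set.MapsTo g (window q N) (window q N) := by
  rintro x ⟨hx, hx'⟩
  refine ⟨by rw [hg.level_apply, hx, add_zero], fun k hk => ?_⟩
  by_contra hne
  have h1 : g (g x) = g x := by
    rw [hg.apply_of_isOutside (g x) (Or.inr ⟨k, hk, hne⟩)]
    ext1 <;> simp [TreeVertex.translate]
  rw [g.injective h1] at hne
  exact hne (hx' k hk)

theorem apply_parent_iterate (hg : IsTranslationOutside N 0 g) (n : ℕ) (x : TreeVertex q) :
    g (parent^[n] x) = parent^[n] (g x) :=
  Function.Semiconj.iterate_right (f := g) hg.parent_apply n x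

theorem eq_of_eqOn_window (hN : 0 ≤ N) (hg : IsTranslationOutside N 0 g)
    (hh : IsTranslationOutside N 0 h) (hgh : Set.EqOn g h (window q N)) : g = h := by
  ext1 x
  by_cases hx : x.IsOutside N
  · rw [hg.apply_of_isOutside x hx, hh.apply_of_isOutside x hx]
  simp only [IsOutside, not_or, not_exists, not_and, not_le, not_not] at hx
  obtain ⟨hlev, hlab⟩ := hx
  rcases le_or_gt (-N) x.level with h1 | h1
  · -- `x` is an ancestor of the vertex of the window obtained by descending along labels `0`.
    let y : TreeVertex q :=
      { level := -N
        label := x.label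
        label_of_lt := fun k hk => x.label_of_lt k (by omega)
        label_eventually := x.label_eventually }
    have hyx : parent^[(x.level + N).toNat] y = x := by
      have hl : (parent^[(x.level + N).toNat] y).level = x.level := by
        rw [level_parent_iterate]
        change -N + _ = _
        omega
      refine TreeVertex.ext hl (funext fun k => ?_)
      by_cases hk : k < x.level
      · rw [label_of_lt _ k (hk.trans_eq hl.symm), x.label_of_lt k hk]
      · refine label_parent_iterate _ y k ?_
        change -N + _ ≤ _
        omega
    have hy : g y = h y := hgh ⟨rfl, hlab⟩
    rw [← hyx, hg.apply_parent_iterate, hh.apply_parent_iterate, hy]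
  · -- The ancestor of `x` in the window determines the labels at positions `≥ -N`, and the other
    -- labels are preserved.
    have hy : parent^[(-N - x.level).toNat] x ∈ window q N := by
      refine ⟨by rw [level_parent_iterate]; omega, fun k hk => ?_⟩
      rw [label_parent_iterate _ _ _ (by omega), hlab k hk]
    have hgx := hg.level_apply x
    have hhx := hh.level_apply x
    refine TreeVertex.ext (hgx.trans hhx.symm) (funext fun k => ?_)
    by_cases hk : k < -N
    · have h2 := hg.label_apply x k hk
      have h3 := hh.label_apply x k hk
      rw [add_zero] at h2 h3
      rw [h2, h3]
    · have h2 := congrArg (fun z : TreeVertex q => z.label k) (hgh hy)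
      simp only [hg.apply_parent_iterate, hh.apply_parent_iterate] at h2
      rwa [label_parent_iterate _ _ _ (by omega), label_parent_iterate _ _ _ (by omega)] at h2

end IsTranslationOutside

theorem finite_boundedSupportSubgroup {N : ℤ} (hN : 0 ≤ N) :
    Finite (boundedSupportSubgroup q N) := by
  have := (finite_window q N).to_subtype
  refine Finite.of_injective
    (fun g : boundedSupportSubgroup q N => (IsTranslationOutside.mapsTo_window g.2).restrict) ?_
  intro g h hgh
  refine Subtype.ext (IsTranslationOutside.eq_of_eqOn_window hN g.2 h.2 fun x hx => ?_)
  exact congrArg Subtype.val (congrFun hgh ⟨x, hx⟩)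

variable (q)

/-- The homomorphism to `ℤ` given by the displacement of levels, which is the same for all
vertices. -/
def levelHom : discreteAffineGroup q F →* Multiplicative ℤ where
  toFun g := Multiplicative.ofAdd (g.1 (ray q 0)).level
  map_one' := rfl
  map_mul' g h := by
    obtain ⟨N, c, hg⟩ := IsTranslationOutside.exists_of_mem g.2
    rw [← ofAdd_add]
    congr 1
    change (g.1 (h.1 (ray q 0))).level = _
    rw [hg.level_apply, hg.level_apply]
    simp only [ray]
    ring

theorem levelHom_surjective : Function.Surjective (levelHom q F) := fun n => by
  refine ⟨affineGenerator q F none ^ n.toAdd, ?_⟩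
  rw [map_zpow]
  have : levelHom q F (affineGenerator q F none) = Multiplicative.ofAdd 1 := rfl
  rw [this, ← ofAdd_zsmul]
  simp

theorem exists_mem_boundedSupportSubgroup (g : (levelHom q F).ker) :
    ∃ N : ℤ, ∀ M ≥ N, g.1.1 ∈ boundedSupportSubgroup q M := by
  obtain ⟨N, c, hg⟩ := IsTranslationOutside.exists_of_mem g.1.2
  have hc : (g.1.1 (ray q 0)).level = 0 := congrArg Multiplicative.toAdd g.2
  rw [hg.level_apply] at hc
  obtain rfl : c = 0 := by simpa [ray] using hc
  exact ⟨N, fun M hM => hg.mono hM⟩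

theorem isLocallyFiniteGroup_ker_levelHom : IsLocallyFiniteGroup (levelHom q F).ker := by
  rintro K ⟨S, rfl⟩
  choose N hN using exists_mem_boundedSupportSubgroup q F
  obtain ⟨M, hM⟩ := (insert 0 (S.image N)).exists_le
  let ι : (levelHom q F).ker →* (regularTree q ≃g regularTree q) :=
    (discreteAffineGroup q F).subtype.comp (levelHom q F).ker.subtype
  have hle : Subgroup.closure (S : Set (levelHom q F).ker) ≤
      (boundedSupportSubgroup q M).comap ι := by
    rw [Subgroup.closure_le]
    intro s hs
    exact hN s M (hM _ (Finset.mem_insert_of_mem (Finset.mem_image_of_mem N hs)))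
  have := finite_boundedSupportSubgroup (q := q) (hM 0 (Finset.mem_insert_self _ _))
  refine Finite.of_injective (fun g : Subgroup.closure (S : Set (levelHom q F).ker) =>
    (⟨ι g.1, hle g.2⟩ : boundedSupportSubgroup q M)) fun g h hgh => ?_
  have h1 := congrArg Subtype.val hgh
  exact Subtype.ext (Subtype.ext (Subtype.ext h1))

end DiscreteAffineGroup

theorem proposition4p6 (q : ℕ) [NeZero q] (hq : 2 ≤ q)
    (F : Type*) [Group F] [Finite F] [MulAction F (Fin q)] [FaithfulSMul F (Fin q)]
    [MulAction.IsPretransitive F (Fin q)] :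
    Group.FG (discreteAffineGroup q F) ∧
      IsLocallyFiniteByInt (discreteAffineGroup q F) ∧
      ¬ HasPropertyHFD (discreteAffineGroup q F) :=
  ⟨fg_discreteAffineGroup F,
    ⟨levelHom q F, levelHom_surjective q F, isLocallyFiniteGroup_ker_levelHom q F⟩,
    not_hasPropertyHFD_discreteAffineGroup F hq⟩
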